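/- Let $E$ be a uniformly convex and uniformly smooth real Banach space with dual $E^*$, and let $J\colon E\to E^*$ be the normalized duality mapping, that is, $Jx$ is the unique $x^*\in E^*$ with $\langle x,x^*\rangle=\|x\|^2=\|x^*\|^2$; under these assumptions $J$ is a well-defined bijection. Put $\phi(x,y)=\|x\|^2-2\langle x,Jy\rangle+\|y\|^2$ for $x,y\in E$, and for a nonempty closed convex set $D\subset E$ and $x\in E$ let $Q_D(x)$ be the unique point of $D$ at which $\phi(\cdot,x)$ attains its minimum over $D$. Let $C$ be a nonempty closed convex subset of $E$ and let $T\colon C\to E$ be relatively nonexpansive, which means the following: the set $F(T)=\{p\in C: Tp=p\}$ is nonempty; $\phi(p,Tx)\le\phi(p,x)$ for all $x\in C$ and $p\in F(T)$; and $F(T)$ is equal to the set of all $p\in C$ for which there is a sequence $\{y_n\}$ in $C$ that converges weakly to $p$ and satisfies $\|y_n-Ty_n\|\to 0$. Let $\{\alpha_n\}_{n\ge 1}$ be a sequence in $(0,1]$ with $\alpha_n\to 0$ and $\sum_{n=1}^\infty\alpha_n=\infty$, and let $\{\beta_n\}_{n\ge 1}$ be a sequence in $[0,1]$ with $0<\liminf_{n\to\infty}\beta_n\le\limsup_{n\to\infty}\beta_n<1$.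 Let $u\in E$, $x_1\in C$, and $$x_{n+1}=Q_C J^{-1}\Bigl(\alpha_n Ju+(1-\alpha_n)\bigl(\beta_n Jx_n+(1-\beta_n)JTx_n\bigr)\Bigr)\qquad(n=1,2,\dots).$$ Then there is a unique point $Q_{F(T)}(u)$ of $F(T)$ at which $\phi(\cdot,u)$ attains its minimum over $F(T)$, and $\{x_n\}$ converges strongly (in norm) to $Q_{F(T)}(u)$. -/

import Mathlib

open Filter Topology

namespace BanachGeom

section Defs

variable {E : Type*} [NormedAddCommGroup E] [NormedSpace ℝ E]

/-- `E` is uniformly smooth: the limit of `(‖x + t y‖ - ‖x‖) / t` as `t → 0`, `t ≠ 0`, exists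
uniformly for `x`, `y` in the unit sphere. -/
def UniformlySmooth (E : Type*) [NormedAddCommGroup E] [NormedSpace ℝ E] : Prop :=
  ∃ g : E × E → ℝ,
    TendstoUniformlyOn (fun (t : ℝ) (p : E × E) => (‖p.1 + t • p.2‖ - ‖p.1‖) / t) g (𝓝[≠] 0)
      (Metric.sphere (0 : E) 1 ×ˢ Metric.sphere (0 : E) 1)

/-- The (set-valued) normalized duality mapping of `E`. -/
def dualitySet (x : E) : Set (StrongDual ℝ E) :=
  {f | f x = ‖x‖ ^ 2 ∧ ‖x‖ ^ 2 = ‖f‖ ^ 2}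

theorem dualitySet_nonempty (x : E) : (dualitySet x).Nonempty := by
  obtain ⟨g, hg, hgx⟩ := exists_dual_vector'' ℝ x
  have hgx' : g x = ‖x‖ := by simpa using hgx
  refine ⟨‖x‖ • g, ?_, ?_⟩
  · simp [hgx', pow_two]
  · rcases eq_or_ne x 0 with rfl | hx
    · simp
    · have hx' : 0 < ‖x‖ := norm_pos_iff.mpr hx
      have h1 : ‖g‖ = 1 := by
        refine le_antisymm hg ?_
        have h2 := g.le_opNorm x
        rw [hgx', Real.norm_of_nonneg hx'.le] at h2
        nlinarith
      simp [norm_smul, h1]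

/-- The normalized duality mapping as a point-to-point map. In a smooth space `dualitySet x` is a
singleton and `J x` is its element. -/
noncomputable def J (x : E) : StrongDual ℝ E := (dualitySet_nonempty x).choose

theorem J_mem (x : E) : J x ∈ dualitySet x := (dualitySet_nonempty x).choose_spec

/-- The inverse of the duality mapping, which is a bijection of `E` onto its dual if `E` is smooth,
strictly convex and reflexive. -/
noncomputable def Jinv (f : StrongDual ℝ E) : E := Function.invFun (J (E := E)) f

/-- `φ(x, y) = ‖x‖² - 2⟨x, J y⟩ + ‖y‖²`. -/
noncomputable def phi (x y : E) : ℝ := ‖x‖ ^ 2 - 2 * J y x + ‖y‖ ^ 2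

/-- `z` is a point of `C` at which `φ(·, x)` attains its minimum over `C`. -/
def IsGenProj (C : Set E) (x z : E) : Prop := z ∈ C ∧ ∀ y ∈ C, phi z x ≤ phi y x

/-- The generalized projection `Q_C`: the point of `C` minimizing `φ(·, x)` over `C`, which exists
and is unique if `C` is nonempty, closed and convex and `E` is smooth, strictly convex and
reflexive. -/
noncomputable def genProj (C : Set E) (x : E) : E := Classical.epsilon (IsGenProj C x)

/-- The fixed points of a map defined on `C`. Maps `C → E` are given here by functions `E → E` of
which only the values on `C` are used. -/
def fixedSet (C : Set E) (T : E → E) : Set E := {p | p ∈ C ∧ T p = p}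

/-- The asymptotic fixed points of `T : C → E`: the weak limits in `C` of sequences `y` in `C` with
`y n - T (y n) → 0` in norm. -/
def asympFixedSet (C : Set E) (T : E → E) : Set E :=
  {p | p ∈ C ∧ ∃ y : ℕ → E, (∀ n, y n ∈ C) ∧
    Tendsto (fun n => toWeakSpace ℝ E (y n)) atTop (𝓝 (toWeakSpace ℝ E p)) ∧
    Tendsto (fun n => y n - T (y n)) atTop (𝓝 0)}

/-- `T : C → E` is of type (r). -/
def IsTypeR (C : Set E) (T : E → E) : Prop :=
  (fixedSet C T).Nonempty ∧ ∀ x ∈ C, ∀ p ∈ fixedSet C T, phi p (T x) ≤ phi p x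

/-- `T : C → E` is relatively nonexpansive. -/
def IsRelNonexpansive (C : Set E) (T : E → E) : Prop :=
  IsTypeR C T ∧ fixedSet C T = asympFixedSet C T

end Defs

end BanachGeom

/-! Let w be the projection of u onto F(T), let J z_n = β_n J x_n + (1 - β_n) J T x_n and J y_n =
α_n J u + (1 - α_n) J z_n, so that x_{n+1} = Q_C y_n. As a function of J y, φ(w, y) is convex with
an explicit defect (`phi_add_eq_of_J_eq`). With relative nonexpansiveness this gives, for s_n = φ(w,
x_n), s_{n+1} ≤ (1 - α_n)(s_n - d_n) + α_n b_n, where d_n = φ(y_n, z_n) + β_n φ(z_n, x_n) + (1 -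
β_n) φ(z_n, T x_n) and b_n = 2⟨y_n - w, Ju - Jw⟩.

Where d_n stays away from 0, its decrease beats α_n b_n, since α_n → 0. Where d_n → 0 along a
subsequence, x_n, y_n and T x_n merge, weak cluster points v are fixed points, and ⟨v - w, Ju - Jw⟩
≤ 0 (`IsRelNonexpansive.exists_apply_sub_le`). Hence s_n → 0 by `tendsto_zero_of_halpern_recursion`,
and uniform convexity turns this into norm convergence.

Minimizers, surjectivity of J and weak limits all rest on nested closed convex sets
(`exists_forall_mem_of_antitone`). -/

namespace BanachGeom

/-! ### Uniform convexity, nested convex sets and minimizers. -/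

section UniformConvexity

variable {E : Type*} [NormedAddCommGroup E] [NormedSpace ℝ E]

instance uniformConvexSpace_submodule [UniformConvexSpace E] (M : Submodule ℝ E) :
    UniformConvexSpace M where
  uniform_convex ε hε := by
    obtain ⟨δ, hδ, h⟩ := exists_forall_sphere_dist_add_le_two_sub E hε
    exact ⟨δ, hδ, fun x hx y hy hxy => h (x := (x : E)) hx (y := (y : E)) hy hxy⟩

/-- Lets the duality argument run inside the separable closed span of a sequence. -/
theorem UniformlySmooth.submodule (hE : UniformlySmooth E) (M : Submodule ℝ E) :
    UniformlySmooth M := by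
  obtain ⟨g, hg⟩ := hE
  refine ⟨fun p => g (p.1, p.2), ?_⟩
  rw [Metric.tendstoUniformlyOn_iff] at hg ⊢
  intro ε hε
  filter_upwards [hg ε hε] with t ht p hp
  exact ht ((p.1 : E), (p.2 : E)) (by simpa using hp)

/-- The squared norm of a uniformly convex space is uniformly convex on bounded sets. -/
theorem exists_norm_midpoint_sq_le [UniformConvexSpace E] (R : ℝ) {ε : ℝ} (hε : 0 < ε) :
    ∃ δ, 0 < δ ∧ ∀ x y : E, ‖x‖ ≤ R → ‖y‖ ≤ R → ε ≤ ‖x - y‖ →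
      ‖(1 / 2 : ℝ) • (x + y)‖ ^ 2 + δ ≤ (‖x‖ ^ 2 + ‖y‖ ^ 2) / 2 := by
  rcases le_or_gt R 0 with hR | hR
  · refine ⟨1, one_pos, fun x y hx hy hxy => ?_⟩
    have := norm_sub_le x y
    linarith
  obtain ⟨δ₀, hδ₀, h⟩ := exists_forall_closed_ball_dist_add_le_two_sub E (div_pos hε hR)
  -- The cap at 1 gives d² ≤ d.
  set d := min δ₀ 1 with hd
  have hd0 : 0 < d := lt_min hδ₀ one_pos
  have hd1 : d ≤ 1 := min_le_right _ _
  have hdδ : d ≤ δ₀ := min_le_left _ _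
  have key : ∀ x y : E, ‖x‖ ≤ R → ‖y‖ ≤ ‖x‖ → ε ≤ ‖x - y‖ →
      ‖(1 / 2 : ℝ) • (x + y)‖ ^ 2 + ε ^ 2 * d ^ 2 / 256 ≤ (‖x‖ ^ 2 + ‖y‖ ^ 2) / 2 := by
    intro x y hx hyx hxy
    set r := ‖x‖ with hr
    have hεr : ε ≤ 2 * r := by
      have := norm_sub_le x y
      linarith
    have hr0 : 0 < r := by linarith
    have hm : ‖(1 / 2 : ℝ) • (x + y)‖ = ‖x + y‖ / 2 := by
      rw [norm_smul]; norm_num; ring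
    rw [hm]
    have h1 : ‖x + y‖ ≤ r * (2 - d) := by
      have h2 : ‖r⁻¹ • x + r⁻¹ • y‖ ≤ 2 - δ₀ := by
        refine h ?_ ?_ ?_
        · rw [norm_smul_of_nonneg (by positivity), ← hr, inv_mul_cancel₀ hr0.ne']
        · rw [norm_smul_of_nonneg (by positivity), inv_mul_le_iff₀ hr0]; linarith
        · rw [← smul_sub, norm_smul_of_nonneg (by positivity), inv_mul_eq_div]
          calc ε / R ≤ ε / r := div_le_div_of_nonneg_left hε.le hr0 hx
            _ ≤ _ := by gcongr
      rw [← smul_add, norm_smul_of_nonneg (by positivity), inv_mul_le_iff₀ hr0] at h2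
      exact h2.trans (by gcongr)
    have h3 : ‖x + y‖ ≤ r + ‖y‖ := norm_add_le x y
    have h0 := norm_nonneg (x + y)
    have hy0 := norm_nonneg y
    have hA : ε ^ 2 ≤ (2 * r) ^ 2 := by gcongr
    obtain ⟨t, ht⟩ : ∃ t, t = r - ‖y‖ := ⟨_, rfl⟩
    have hyt : ‖y‖ = r - t := by linarith
    have ht0 : 0 ≤ t := by linarith
    rw [hyt] at h3 ⊢
    have hB : ε ^ 2 * d ^ 2 ≤ (2 * r) ^ 2 * d ^ 2 := by gcongr
    -- Nearly equal norms: uniform convexity of the ball gives the gain. Otherwise the gap t alone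
    -- gains t²/4 ≥ r²d²/64 ≥ ε²d²/256, as ε ≤ 2r.
    rcases le_or_gt t (r * d / 4) with htd | htd
    · have h4 : ‖x + y‖ ^ 2 ≤ (r * (2 - d)) ^ 2 := by gcongr
      have h5 : r * t ≤ r * (r * d / 4) := by gcongr
      have h6 : r ^ 2 * d ^ 2 ≤ r ^ 2 * d := by
        have : d ^ 2 ≤ d := by nlinarith
        gcongr
      nlinarith [sq_nonneg t]
    · have h4 : ‖x + y‖ ^ 2 ≤ (r + (r - t)) ^ 2 := by gcongr
      have h5 : (r * d / 4) ^ 2 ≤ t ^ 2 := by gcongr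
      nlinarith
  refine ⟨ε ^ 2 * d ^ 2 / 256, by positivity, fun x y hx hy hxy => ?_⟩
  rcases le_total ‖y‖ ‖x‖ with hyx | hyx
  · exact key x y hx hyx hxy
  · have := key y x hy hyx (by rwa [norm_sub_rev])
    rwa [add_comm y x, add_comm (‖y‖ ^ 2)] at this

/-- In a uniformly convex Banach space, a decreasing sequence of nonempty bounded closed convex
sets has a common point. -/
theorem exists_forall_mem_of_antitone [UniformConvexSpace E] [CompleteSpace E] {K : ℕ → Set E}
    (hanti : Antitone K) (hne : ∀ n, (K n).Nonempty) (hcl : ∀ n, IsClosed (K n))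
    (hconv : ∀ n, Convex ℝ (K n)) {R : ℝ} (hR : ∀ x ∈ K 0, ‖x‖ ≤ R) :
    ∃ v, ∀ n, v ∈ K n := by
  set c : ℕ → ℝ := fun n => sInf ((fun x => ‖x‖ ^ 2) '' K n) with hc
  have hbdd : ∀ n, BddBelow ((fun x : E => ‖x‖ ^ 2) '' K n) := fun n =>
    ⟨0, by rintro _ ⟨x, -, rfl⟩; positivity⟩
  have hcle : ∀ n, ∀ x ∈ K n, c n ≤ ‖x‖ ^ 2 := fun n x hx => csInf_le (hbdd n) ⟨x, hx, rfl⟩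
  have hcmono : Monotone c := fun m n hmn =>
    csInf_le_csInf (hbdd m) ((hne n).image _) (Set.image_mono (hanti hmn))
  have hcbdd : BddAbove (Set.range c) := by
    refine ⟨R ^ 2, ?_⟩
    rintro _ ⟨n, rfl⟩
    obtain ⟨x, hx⟩ := hne n
    exact (hcle n x hx).trans (pow_le_pow_left₀ (norm_nonneg _) (hR x (hanti (Nat.zero_le n) hx)) 2)
  have hclim := tendsto_atTop_ciSup hcmono hcbdd
  set L := ⨆ n, c n
  have hv : ∀ n, ∃ v ∈ K n, ‖v‖ ^ 2 < c n + 1 / ((n : ℝ) + 1) := fun n => by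
    obtain ⟨_, ⟨x, hx, rfl⟩, hlt⟩ := exists_lt_of_csInf_lt ((hne n).image (fun x : E => ‖x‖ ^ 2))
      (show c n < c n + 1 / ((n : ℝ) + 1) by have : 0 < 1 / ((n : ℝ) + 1) := by positivity
                                             linarith)
    exact ⟨x, hx, hlt⟩
  choose v hvK hvlt using hv
  -- For m ≤ n the midpoint of v m and v n lies in K m, so its squared norm is at least c m; as c
  -- converges, uniform convexity forces v m and v n together.
  have hcauchy : CauchySeq v := by
    rw [Metric.cauchySeq_iff]
    intro ε hε
    obtain ⟨δ, hδ, hmid⟩ := exists_norm_midpoint_sq_le (E := E) R hε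
    have h1 : ∀ᶠ n in atTop, L - δ / 2 < c n := hclim.eventually_const_lt (by linarith)
    have h2 : ∀ᶠ n : ℕ in atTop, 1 / ((n : ℝ) + 1) < δ / 2 :=
      tendsto_one_div_add_atTop_nhds_zero_nat.eventually_lt_const (by linarith)
    obtain ⟨N, hN⟩ := (h1.and h2).exists_forall_of_atTop
    have main : ∀ m ≥ N, ∀ n ≥ m, ‖v m - v n‖ < ε := by
      intro m hm n hn
      by_contra! hcon
      have h3 := hmid (v m) (v n) (hR _ (hanti (Nat.zero_le m) (hvK m)))
        (hR _ (hanti (Nat.zero_le n) (hvK n))) hcon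
      have h4 : (1 / 2 : ℝ) • (v m + v n) ∈ K m := by
        rw [smul_add]
        exact hconv m (hvK m) (hanti hn (hvK n)) (by norm_num) (by norm_num) (by norm_num)
      have h5 := hcle m _ h4
      have h6 := hvlt m
      have h7 := hvlt n
      have h8 := hN m hm
      have h9 := hN n (le_trans hm hn)
      have h10 : c n ≤ L := le_ciSup hcbdd n
      have h11 : c m ≤ L := le_ciSup hcbdd m
      linarith
    refine ⟨N, fun m hm n hn => ?_⟩
    rw [dist_eq_norm]
    rcases le_total m n with h | h
    · exact main m hm n h
    · rw [norm_sub_rev]; exact main n hn m h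
  obtain ⟨w, hw⟩ := cauchySeq_tendsto_of_complete hcauchy
  exact ⟨w, fun n => (hcl n).mem_of_tendsto hw
    (eventually_atTop.2 ⟨n, fun m hm => hanti hm (hvK m)⟩)⟩

theorem convexOn_norm_sq : ConvexOn ℝ Set.univ (fun x : E => ‖x‖ ^ 2) :=
  convexOn_univ_norm.pow (fun _ _ => norm_nonneg _) 2

/-- On a nonempty closed convex set, `‖·‖² - 2 f` attains its minimum. -/
theorem exists_isMinOn_norm_sq_sub [UniformConvexSpace E] [CompleteSpace E] {D : Set E}
    (hne : D.Nonempty) (hcl : IsClosed D) (hconv : Convex ℝ D) (f : StrongDual ℝ E) :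
    ∃ z ∈ D, ∀ y ∈ D, ‖z‖ ^ 2 - 2 * f z ≤ ‖y‖ ^ 2 - 2 * f y := by
  set G : E → ℝ := fun y => ‖y‖ ^ 2 - 2 * f y with hG
  have hGconv : ConvexOn ℝ D G := by
    have h1 : ConvexOn ℝ D (fun x : E => ‖x‖ ^ 2) := convexOn_norm_sq.subset (Set.subset_univ _) hconv
    have h2 : ConcaveOn ℝ D (fun x : E => 2 * f x) :=
      ((2 : ℝ) • (f : E →ₗ[ℝ] ℝ)).concaveOn hconv
    exact h1.sub h2
  have hGcont : Continuous G := by fun_prop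
  have hlow : ∀ y, ‖y‖ ^ 2 - 2 * (‖f‖ * ‖y‖) ≤ G y := fun y => by
    have := (Real.le_norm_self _).trans (f.le_opNorm y)
    simp only [hG]; linarith
  have hbdd : BddBelow (G '' D) := ⟨-‖f‖ ^ 2, by
    rintro _ ⟨y, -, rfl⟩
    nlinarith [hlow y, sq_nonneg (‖y‖ - ‖f‖)]⟩
  set c := sInf (G '' D)
  let K : ℕ → Set E := fun n => {y ∈ D | G y ≤ c + 1 / ((n : ℝ) + 1)}
  have hK : ∃ z, ∀ n, z ∈ K n := by
    -- On K 0 the slack is 1, so ‖y‖(‖y‖ - 2‖f‖) ≤ |c| + 1, which fails beyond this radius.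
    refine exists_forall_mem_of_antitone (R := 2 * ‖f‖ + |c| + 1 + 1) ?_ ?_ ?_ ?_ ?_
    · intro m n hmn y hy
      exact ⟨hy.1, hy.2.trans (by gcongr)⟩
    · intro n
      obtain ⟨_, ⟨x, hx, rfl⟩, hlt⟩ := exists_lt_of_csInf_lt (hne.image G)
        (show c < c + 1 / ((n : ℝ) + 1) by have : 0 < 1 / ((n : ℝ) + 1) := by positivity
                                           linarith)
      exact ⟨x, hx, hlt.le⟩
    · exact fun n => hcl.inter (isClosed_le hGcont continuous_const)
    · exact fun n => hGconv.convex_le _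
    · rintro y ⟨-, hy⟩
      have h1 := hlow y
      have h2 := le_abs_self c
      norm_num at hy
      by_contra! h3
      have h4 := norm_nonneg f
      have h5 := abs_nonneg c
      have h6 : (‖y‖ - 2 * ‖f‖) * ‖y‖ ≤ |c| + 1 := by nlinarith
      nlinarith
  obtain ⟨z, hz⟩ := hK
  refine ⟨z, (hz 0).1, fun y hy => ?_⟩
  have h1 : G z ≤ c := by
    have hlim : Tendsto (fun n : ℕ => c + 1 / ((n : ℝ) + 1)) atTop (𝓝 c) := by
      simpa using tendsto_one_div_add_atTop_nhds_zero_nat.const_add c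
    exact ge_of_tendsto' hlim fun n => (hz n).2
  exact h1.trans (csInf_le hbdd ⟨y, hy, rfl⟩)

end UniformConvexity

/-! ### The duality mapping: continuity, variational inequality, surjectivity. -/

section Duality

variable {E : Type*} [NormedAddCommGroup E] [NormedSpace ℝ E]

theorem J_self (x : E) : J x x = ‖x‖ ^ 2 := (J_mem x).1

theorem norm_J (x : E) : ‖J x‖ = ‖x‖ :=
  ((sq_eq_sq₀ (norm_nonneg _) (norm_nonneg _)).1 (J_mem x).2).symm

theorem J_apply_le (x y : E) : J x y ≤ ‖x‖ * ‖y‖ := by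
  have := (Real.le_norm_self _).trans ((J x).le_opNorm y)
  rwa [norm_J] at this

theorem phi_self (x : E) : phi x x = 0 := by
  rw [phi, J_self]; ring

theorem sq_norm_sub_norm_le_phi (x y : E) : (‖x‖ - ‖y‖) ^ 2 ≤ phi x y := by
  have := J_apply_le y x
  rw [phi]; nlinarith

theorem phi_nonneg (x y : E) : 0 ≤ phi x y :=
  (sq_nonneg _).trans (sq_norm_sub_norm_le_phi x y)

/-- On bounded sets `phi x y` is small only if `x` and `y` are close. -/
theorem exists_norm_sub_lt_of_phi_lt [UniformConvexSpace E] (R : ℝ) {ε : ℝ} (hε : 0 < ε) :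
    ∃ δ, 0 < δ ∧ ∀ x y : E, ‖x‖ ≤ R → ‖y‖ ≤ R → phi x y < δ → ‖x - y‖ < ε := by
  obtain ⟨δ, hδ, h⟩ := exists_norm_midpoint_sq_le (E := E) R hε
  refine ⟨δ, hδ, fun x y hx hy hphi => ?_⟩
  by_contra! hcon
  have h1 := h x y hx hy hcon
  have h2 := J_apply_le y ((1 / 2 : ℝ) • (x + y))
  rw [map_smul, map_add, J_self, smul_eq_mul] at h2
  -- With m the midpoint, this and `h2` give J y x ≤ ‖m‖², so φ(x, y) ≥ ‖x‖² + ‖y‖² - 2‖m‖² ≥ 2δ.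
  have h3 := sq_nonneg (‖y‖ - ‖(1 / 2 : ℝ) • (x + y)‖)
  rw [phi] at hphi
  nlinarith

theorem tendsto_sub_of_tendsto_phi [UniformConvexSpace E] {ι : Type*} {l : Filter ι} {x y : ι → E}
    {R : ℝ} (hx : ∀ i, ‖x i‖ ≤ R) (hy : ∀ i, ‖y i‖ ≤ R)
    (h : Tendsto (fun i => phi (x i) (y i)) l (𝓝 0)) :
    Tendsto (fun i => x i - y i) l (𝓝 0) := by
  rw [NormedAddGroup.tendsto_nhds_zero]
  intro ε hε
  obtain ⟨δ, hδ, hd⟩ := exists_norm_sub_lt_of_phi_lt (E := E) R hε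
  filter_upwards [h.eventually_lt_const hδ] with i hi
  exact hd _ _ (hx i) (hy i) hi

theorem eq_of_phi_eq_zero [UniformConvexSpace E] {x y : E} (h : phi x y = 0) : x = y := by
  by_contra hne
  have hpos : 0 < ‖x - y‖ := norm_pos_iff.2 (sub_ne_zero.2 hne)
  obtain ⟨δ, hδ, hd⟩ := exists_norm_sub_lt_of_phi_lt (E := E) (max ‖x‖ ‖y‖) hpos
  exact lt_irrefl _ (hd x y (le_max_left _ _) (le_max_right _ _) (h ▸ hδ))

/-- The subgradient inequality: 2 J x supports ‖·‖² at x. -/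
theorem norm_sq_sub_le (x y : E) : ‖x‖ ^ 2 - ‖y‖ ^ 2 ≤ 2 * J x (x - y) := by
  have := J_apply_le x y
  rw [map_sub, J_self]
  nlinarith [sq_nonneg (‖x‖ - ‖y‖)]

/-- In a uniformly smooth space the duality mapping is norm-to-norm continuous. -/
theorem UniformlySmooth.continuous_J (hE : UniformlySmooth E) : Continuous (J (E := E)) := by
  obtain ⟨g, hg⟩ := hE
  rw [Metric.tendstoUniformlyOn_iff] at hg
  have hdiff : ∀ x h : E, ‖x‖ = 1 → ‖h‖ = 1 →
      Tendsto (fun t : ℝ => (‖x + t • h‖ - ‖x‖) / t) (𝓝[≠] 0) (𝓝 (g (x, h))) := by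
    intro x h hx hh
    rw [Metric.tendsto_nhds]
    intro ε hε
    filter_upwards [hg ε hε] with t ht
    rw [dist_comm]
    exact ht (x, h) (by simp [hx, hh])
  have hnormalize : ∀ x : E, x ≠ 0 → ‖‖x‖⁻¹ • x‖ = 1 := fun x hx => by
    rw [norm_smul, norm_inv, norm_norm, inv_mul_cancel₀ (norm_ne_zero_iff.2 hx)]
  -- The supporting functional lies between the left and right derivatives of the norm, which agree.
  have hJg : ∀ x h : E, x ≠ 0 → ‖h‖ = 1 → J x h = ‖x‖ * g (‖x‖⁻¹ • x, h) := by
    intro x h hx hh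
    have hx0 : 0 < ‖x‖ := norm_pos_iff.2 hx
    set e := ‖x‖⁻¹ • x
    have he : ‖e‖ = 1 := hnormalize x hx
    have hle : ∀ t : ℝ, t * (‖x‖⁻¹ * J x h) ≤ ‖e + t • h‖ - ‖e‖ := fun t => by
      have h1 := J_apply_le x (e + t • h)
      have h2 : J x e = ‖x‖ := by
        simp only [e, map_smul, J_self, smul_eq_mul]; field_simp
      rw [(J x).map_add, h2, (J x).map_smul, smul_eq_mul] at h1
      rw [he, ← mul_le_mul_iff_right₀ hx0]
      have : ‖x‖ * (t * (‖x‖⁻¹ * J x h)) = t * J x h := by field_simp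
      linarith
    have h1 : ‖x‖⁻¹ * J x h ≤ g (e, h) := by
      refine ge_of_tendsto ((hdiff e h he hh).mono_left
        (nhdsWithin_mono 0 (fun t (ht : t ∈ Set.Ioi (0 : ℝ)) => (ne_of_gt ht : t ≠ 0)))) ?_
      filter_upwards [self_mem_nhdsWithin] with t (ht : 0 < t)
      rw [le_div_iff₀ ht, mul_comm]
      exact hle t
    have h2 : g (e, h) ≤ ‖x‖⁻¹ * J x h := by
      refine le_of_tendsto ((hdiff e h he hh).mono_left
        (nhdsWithin_mono 0 (fun t (ht : t ∈ Set.Iio (0 : ℝ)) => (ne_of_lt ht : t ≠ 0)))) ?_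
      filter_upwards [self_mem_nhdsWithin] with t (ht : t < 0)
      rw [div_le_iff_of_neg ht, mul_comm]
      exact hle t
    rw [← le_antisymm h1 h2]
    field_simp
  rw [continuous_iff_continuousAt]
  intro x
  rcases eq_or_ne x 0 with rfl | hx
  · have hJ0 : J (0 : E) = 0 := by rw [← norm_eq_zero, norm_J, norm_zero]
    rw [ContinuousAt, hJ0, tendsto_zero_iff_norm_tendsto_zero]
    simp_rw [norm_J]
    exact tendsto_norm_zero
  · have hx0 : 0 < ‖x‖ := norm_pos_iff.2 hx
    rw [ContinuousAt, Metric.tendsto_nhds]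
    intro ε hε
    set η := ε / (4 * ‖x‖) with hη
    have hη0 : 0 < η := by positivity
    -- By uniformity one t serves all unit vectors: its difference quotient is within η of g, and on
    -- the unit sphere it is 1/|t|-Lipschitz in the base point.
    obtain ⟨t, htη, ht0 : t ≠ 0⟩ := ((hg η hη0).and self_mem_nhdsWithin).exists
    have hcont : Tendsto (fun y : E => ‖y - x‖ + ‖x‖ * (2 * η +
        ‖‖y‖⁻¹ • y - ‖x‖⁻¹ • x‖ / |t|)) (𝓝 x) (𝓝 (ε / 2)) := by
      have h1 : ContinuousAt (fun y : E => ‖y - x‖ + ‖x‖ * (2 * η +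
        ‖‖y‖⁻¹ • y - ‖x‖⁻¹ • x‖ / |t|)) x := by
        have : ‖x‖ ≠ 0 := hx0.ne'
        fun_prop (disch := assumption)
      have h2 : ε / 2 = ‖x - x‖ + ‖x‖ * (2 * η + ‖‖x‖⁻¹ • x - ‖x‖⁻¹ • x‖ / |t|) := by
        simp [hη]; field_simp; norm_num
      rw [h2]
      exact h1
    filter_upwards [hcont.eventually_lt_const (half_lt_self hε),
      isOpen_ne.mem_nhds hx] with y hy hy0
    rw [dist_eq_norm]
    refine lt_of_le_of_lt ?_ hy
    refine ContinuousLinearMap.opNorm_le_of_unit_norm (by positivity) fun h hh => ?_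
    set a := ‖x‖⁻¹ • x
    set b := ‖y‖⁻¹ • y
    have ha : ‖a‖ = 1 := hnormalize x hx
    have hb : ‖b‖ = 1 := hnormalize y hy0
    have hgab : |g (b, h) - g (a, h)| ≤ 2 * η + ‖b - a‖ / |t| := by
      have h1 := htη (a, h) (by simp [ha, hh])
      have h2 := htη (b, h) (by simp [hb, hh])
      have h3 : |(‖b + t • h‖ - ‖b‖) / t - (‖a + t • h‖ - ‖a‖) / t| ≤ ‖b - a‖ / |t| := by
        rw [← sub_div, abs_div, ha, hb]
        gcongr
        have := abs_norm_sub_norm_le (b + t • h) (a + t • h)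
        simpa using this
      simp only [Real.dist_eq] at h1 h2
      rw [abs_lt] at h1 h2
      rw [abs_le] at h3 ⊢
      constructor <;> linarith
    have hgb : |g (b, h)| ≤ 1 := by
      have h1 := (J y).le_opNorm h
      rw [hJg y h hy0 hh, norm_J, hh, norm_mul, norm_norm] at h1
      exact le_of_mul_le_mul_left h1 (norm_pos_iff.2 hy0)
    rw [sub_apply, hJg y h hy0 hh, hJg x h hx hh, Real.norm_eq_abs,
      show ‖y‖ * g (b, h) - ‖x‖ * g (a, h) = (‖y‖ - ‖x‖) * g (b, h) +
        ‖x‖ * (g (b, h) - g (a, h)) by ring]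
    refine (abs_add_le _ _).trans (add_le_add ?_ ?_)
    · rw [abs_mul]
      calc _ ≤ ‖y - x‖ * 1 := by
            gcongr
            exact abs_norm_sub_norm_le y x
        _ = _ := mul_one _
    · rw [abs_mul, abs_norm]
      gcongr

/-- The variational inequality for minimizers of `‖·‖² - 2 f` over a convex set. -/
theorem UniformlySmooth.apply_sub_le_J (hE : UniformlySmooth E) {D : Set E} (hconv : Convex ℝ D)
    {f : StrongDual ℝ E} {z : E} (hz : z ∈ D)
    (hmin : ∀ y ∈ D, ‖z‖ ^ 2 - 2 * f z ≤ ‖y‖ ^ 2 - 2 * f y) {p : E} (hp : p ∈ D) :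
    f (p - z) ≤ J z (p - z) := by
  -- The subgradient inequality is available at the moved point z + t(p - z); continuity of J
  -- carries it to z.
  have hlim : Tendsto (fun t : ℝ => J (z + t • (p - z)) (p - z)) (𝓝[>] 0) (𝓝 (J z (p - z))) := by
    have h1 : Continuous fun t : ℝ => J (z + t • (p - z)) (p - z) := by
      have := hE.continuous_J
      fun_prop
    have h2 := h1.tendsto 0
    simp only [zero_smul, add_zero] at h2
    exact h2.mono_left nhdsWithin_le_nhds
  refine ge_of_tendsto hlim ?_
  filter_upwards [Ioo_mem_nhdsGT (zero_lt_one' ℝ)] with t ht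
  have h1 := hmin _ (hconv.add_smul_sub_mem hz hp ⟨ht.1.le, ht.2.le⟩)
  have h2 := norm_sq_sub_le (z + t • (p - z)) z
  rw [add_sub_cancel_left, map_smul, smul_eq_mul] at h2
  rw [map_add, map_smul, smul_eq_mul] at h1
  have h3 : t * f (p - z) ≤ t * J (z + t • (p - z)) (p - z) := by linarith
  exact le_of_mul_le_mul_left h3 ht.1

variable [UniformConvexSpace E] [CompleteSpace E]

/-- A minimizer z of ‖·‖² - 2f over the whole space satisfies f ≤ J z in every direction h and -h,
hence equality. -/
theorem UniformlySmooth.surjective_J (hE : UniformlySmooth E) :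
    Function.Surjective (J (E := E)) := by
  intro f
  obtain ⟨z, -, hz⟩ := exists_isMinOn_norm_sq_sub Set.univ_nonempty isClosed_univ convex_univ f
  have key : ∀ h, f h ≤ J z h := fun h => by
    simpa using hE.apply_sub_le_J convex_univ (Set.mem_univ z) hz (Set.mem_univ (z + h))
  refine ⟨z, ContinuousLinearMap.ext fun h => le_antisymm ?_ (key h)⟩
  simpa using key (-h)

theorem UniformlySmooth.J_Jinv (hE : UniformlySmooth E) (f : StrongDual ℝ E) : J (Jinv f) = f :=
  Function.rightInverse_invFun hE.surjective_J f

end Duality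

/-! ### Weakly convergent subsequences. -/

section WeakCompactness

variable {E : Type*} [NormedAddCommGroup E] [NormedSpace ℝ E]

theorem tendsto_toWeakSpace {ι : Type*} {l : Filter ι} {x : ι → E} {v : E}
    (h : ∀ f : StrongDual ℝ E, Tendsto (fun i => f (x i)) l (𝓝 (f v))) :
    Tendsto (fun i => toWeakSpace ℝ E (x i)) l (𝓝 (toWeakSpace ℝ E v)) := by
  refine (WeakBilin.tendsto_iff_forall_eval_tendsto (topDualPairing ℝ E).flip ?_).2 h
  intro a b hab
  exact (SeparatingDual.eq_iff_forall_dual_eq (R := ℝ)).2 fun f => LinearMap.congr_fun hab f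

/-- A bounded sequence has a subsequence along which every functional converges, if the dual is
separable. -/
theorem exists_subseq_forall_dual_tendsto_of_separable
    [TopologicalSpace.SeparableSpace (StrongDual ℝ E)] {x : ℕ → E} {R : ℝ}
    (hR : ∀ n, ‖x n‖ ≤ R) :
    ∃ k : ℕ → ℕ, StrictMono k ∧
      ∀ f : StrongDual ℝ E, ∃ l, Tendsto (fun n => f (x (k n))) atTop (𝓝 l) := by
  let d := TopologicalSpace.denseSeq (StrongDual ℝ E)
  have hd : DenseRange d := TopologicalSpace.denseRange_denseSeq _
  have hR0 : 0 ≤ R := (norm_nonneg _).trans (hR 0)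
  have hbound : ∀ (f : StrongDual ℝ E) n, |f (x n)| ≤ ‖f‖ * R := fun f n =>
    (f.le_opNorm (x n)).trans (by gcongr; exact hR n)
  have hcomp : IsCompact (Set.univ.pi fun i : ℕ => Set.Icc (-(‖d i‖ * R)) (‖d i‖ * R)) :=
    isCompact_univ_pi fun i => isCompact_Icc
  obtain ⟨a, -, k, hk, hlim⟩ := hcomp.tendsto_subseq (x := fun n i => d i (x n))
    fun n i _ => abs_le.1 (hbound (d i) n)
  rw [tendsto_pi_nhds] at hlim
  refine ⟨k, hk, fun f => cauchySeq_tendsto_of_complete ?_⟩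
  rw [Metric.cauchySeq_iff]
  intro ε hε
  obtain ⟨i, hi⟩ := hd.exists_dist_lt f (ε := ε / (4 * (R + 1))) (by positivity)
  have hc : CauchySeq fun n => d i (x (k n)) := (hlim i).cauchySeq
  obtain ⟨N, hN⟩ := Metric.cauchySeq_iff.1 hc (ε / 2) (by positivity)
  have hclose : ∀ n, |f (x (k n)) - d i (x (k n))| ≤ ε / 4 := fun n => by
    refine (hbound (f - d i) (k n)).trans ?_
    rw [dist_eq_norm] at hi
    calc ‖f - d i‖ * R ≤ ε / (4 * (R + 1)) * (R + 1) := by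
          gcongr
          linarith
      _ = ε / 4 := by field_simp
  refine ⟨N, fun m hm n hn => ?_⟩
  have h1 := hN m hm n hn
  have h2 := hclose m
  have h3 := hclose n
  simp only [Real.dist_eq] at h1 ⊢
  rw [abs_lt] at h1 ⊢
  rw [abs_le] at h2 h3
  constructor <;> linarith

variable [UniformConvexSpace E] [CompleteSpace E]

/-- Bounded sequences in a uniformly convex and uniformly smooth Banach space have weakly
convergent subsequences. -/
theorem UniformlySmooth.exists_subseq_tendsto_weak (hE : UniformlySmooth E) {x : ℕ → E} {R : ℝ}
    (hR : ∀ n, ‖x n‖ ≤ R) :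
    ∃ (v : E) (k : ℕ → ℕ), StrictMono k ∧
      (∀ f : StrongDual ℝ E, Tendsto (fun n => f (x (k n))) atTop (𝓝 (f v))) ∧
      ∀ C : Set E, Convex ℝ C → IsClosed C → (∀ n, x n ∈ C) → v ∈ C := by
  obtain ⟨k, hk, hlim⟩ : ∃ k : ℕ → ℕ, StrictMono k ∧
      ∀ f : StrongDual ℝ E, ∃ l, Tendsto (fun n => f (x (k n))) atTop (𝓝 l) := by
    -- M is separable, and so is its dual, being the continuous image of M under its own J.
    set M := (Submodule.span ℝ (Set.range x)).topologicalClosure with hM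
    have hxM : ∀ n, x n ∈ M := fun n =>
      Submodule.le_topologicalClosure _ (Submodule.subset_span ⟨n, rfl⟩)
    have : CompleteSpace M := (Submodule.isClosed_topologicalClosure _).completeSpace_coe
    have : TopologicalSpace.SeparableSpace M :=
      ((Set.countable_range x).isSeparable.span (R := ℝ)).closure.separableSpace
    have hME := hE.submodule M
    have : TopologicalSpace.SeparableSpace (StrongDual ℝ M) :=
      hME.surjective_J.denseRange.separableSpace hME.continuous_J
    obtain ⟨k, hk, hlim⟩ := exists_subseq_forall_dual_tendsto_of_separable (E := M)
      (x := fun n => ⟨x n, hxM n⟩) hR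
    exact ⟨k, hk, fun f => hlim (f.comp M.subtypeL)⟩
  -- A point common to the hulls of all tails must be the weak limit, since f maps late hulls into
  -- small balls around lim f (x (k n)).
  let K : ℕ → Set E := fun m => closedConvexHull ℝ ((fun n => x (k n)) '' Set.Ici m)
  have hK : ∃ v, ∀ m, v ∈ K m := by
    refine exists_forall_mem_of_antitone (R := R) ?_ ?_ ?_ ?_ ?_
    · intro m n hmn
      exact (closedConvexHull ℝ).monotone (Set.image_mono (Set.Ici_subset_Ici.2 hmn))
    · exact fun m => ⟨x (k m), subset_closedConvexHull ⟨m, Set.mem_Ici.2 le_rfl, rfl⟩⟩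
    · exact fun m => isClosed_closedConvexHull
    · exact fun m => convex_closedConvexHull
    · intro y hy
      have hsub : K 0 ⊆ Metric.closedBall 0 R := by
        refine closedConvexHull_min ?_ (convex_closedBall _ _) Metric.isClosed_closedBall
        rintro _ ⟨n, -, rfl⟩
        simpa using hR (k n)
      simpa using hsub hy
  obtain ⟨v, hv⟩ := hK
  refine ⟨v, k, hk, fun f => ?_, fun C hC hCcl hxC => ?_⟩
  · obtain ⟨l, hl⟩ := hlim f
    suffices f v = l by rwa [this]
    refine eq_of_forall_dist_le fun ε hε => ?_
    obtain ⟨N, hN⟩ := Metric.tendsto_atTop.1 hl ε hε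
    have hsub : K N ⊆ f ⁻¹' Metric.closedBall l ε := by
      refine closedConvexHull_min ?_ ?_ (Metric.isClosed_closedBall.preimage f.continuous)
      · rintro _ ⟨n, hn, rfl⟩
        exact (hN n hn).le
      · exact (convex_closedBall l ε).linear_preimage (f : E →ₗ[ℝ] ℝ)
    exact hsub (hv N)
  · refine closedConvexHull_min ?_ hC hCcl (hv 0)
    rintro _ ⟨n, -, rfl⟩
    exact hxC _

end WeakCompactness

/-! ### Generalized projections. -/

section Projection

variable {E : Type*} [NormedAddCommGroup E] [NormedSpace ℝ E]

theorem isGenProj_iff {C : Set E} {x z : E} : IsGenProj C x z ↔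
    z ∈ C ∧ ∀ y ∈ C, ‖z‖ ^ 2 - 2 * J x z ≤ ‖y‖ ^ 2 - 2 * J x y := by
  simp only [IsGenProj, phi, add_le_add_iff_right]

theorem UniformlySmooth.isGenProj_apply_sub_le (hE : UniformlySmooth E) {C : Set E}
    (hconv : Convex ℝ C) {x z p : E} (hz : IsGenProj C x z) (hp : p ∈ C) :
    J x (p - z) ≤ J z (p - z) :=
  hE.apply_sub_le_J hconv hz.1 (isGenProj_iff.1 hz).2 hp

/-- The variational inequality in Pythagorean form. -/
theorem UniformlySmooth.phi_add_phi_le (hE : UniformlySmooth E) {C : Set E}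
    (hconv : Convex ℝ C) {x z p : E} (hz : IsGenProj C x z) (hp : p ∈ C) :
    phi p z + phi z x ≤ phi p x := by
  have h := hE.isGenProj_apply_sub_le hconv hz hp
  simp only [map_sub, J_self] at h
  simp only [phi]
  linarith

variable [UniformConvexSpace E] [CompleteSpace E]

theorem UniformlySmooth.existsUnique_isGenProj (hE : UniformlySmooth E) {C : Set E}
    (hne : C.Nonempty) (hcl : IsClosed C) (hconv : Convex ℝ C) (x : E) :
    ∃! z, IsGenProj C x z := by
  obtain ⟨z, hz, hmin⟩ := exists_isMinOn_norm_sq_sub hne hcl hconv (J x)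
  have hzproj : IsGenProj C x z := isGenProj_iff.2 ⟨hz, hmin⟩
  refine ⟨z, hzproj, fun w hw => eq_of_phi_eq_zero (le_antisymm ?_ (phi_nonneg _ _))⟩
  have h1 := hE.phi_add_phi_le hconv hzproj hw.1
  have h2 := hw.2 z hz
  linarith

theorem UniformlySmooth.isGenProj_genProj (hE : UniformlySmooth E) {C : Set E}
    (hne : C.Nonempty) (hcl : IsClosed C) (hconv : Convex ℝ C) (x : E) :
    IsGenProj C x (genProj C x) :=
  Classical.epsilon_spec (hE.existsUnique_isGenProj hne hcl hconv x).exists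

end Projection

/-! ### The fixed point set is closed and convex. -/

section RelNonexpansive

variable {E : Type*} [NormedAddCommGroup E] [NormedSpace ℝ E] {C : Set E} {T : E → E}

theorem IsRelNonexpansive.mem_fixedSet (hT : IsRelNonexpansive C T) {p : E} (hp : p ∈ C)
    {y : ℕ → E} (hy : ∀ n, y n ∈ C)
    (hlim : ∀ f : StrongDual ℝ E, Tendsto (fun n => f (y n)) atTop (𝓝 (f p)))
    (hyT : Tendsto (fun n => y n - T (y n)) atTop (𝓝 0)) : p ∈ fixedSet C T := by
  rw [hT.2]
  exact ⟨hp, y, hy, tendsto_toWeakSpace hlim, hyT⟩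

/-- A limit of fixed points is an asymptotic fixed point, so T need not be continuous. -/
theorem IsRelNonexpansive.isClosed_fixedSet (hT : IsRelNonexpansive C T) (hC : IsClosed C) :
    IsClosed (fixedSet C T) := by
  refine isClosed_of_closure_subset fun p hp => ?_
  obtain ⟨y, hy, hyp⟩ := mem_closure_iff_seq_limit.1 hp
  refine hT.mem_fixedSet (hC.mem_of_tendsto hyp (Eventually.of_forall fun n => (hy n).1))
    (fun n => (hy n).1) (fun f => (f.continuous.tendsto p).comp hyp) ?_
  simp only [fun n => (hy n).2, sub_self, tendsto_const_nhds]

/-- For z = ap + bq, φ(z, y) - aφ(p, y) - bφ(q, y) does not depend on y. Comparing y = z with y = T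
z gives φ(z, T z) ≤ φ(z, z) = 0. -/
theorem IsTypeR.convex_fixedSet [UniformConvexSpace E] (hT : IsTypeR C T) (hC : Convex ℝ C) :
    Convex ℝ (fixedSet C T) := by
  intro p hp q hq a b ha hb hab
  set z := a • p + b • q with hz
  have hzC : z ∈ C := hC hp.1 hq.1 ha hb hab
  refine ⟨hzC, (eq_of_phi_eq_zero (le_antisymm ?_ (phi_nonneg _ _))).symm⟩
  have h1 := mul_le_mul_of_nonneg_left (hT.2 z hzC p hp) ha
  have h2 := mul_le_mul_of_nonneg_left (hT.2 z hzC q hq) hb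
  have key : ∀ y, phi z y = ‖z‖ ^ 2 + a * phi p y + b * phi q y - a * ‖p‖ ^ 2 - b * ‖q‖ ^ 2 := by
    intro y
    have h3 : J y z = a * J y p + b * J y q := by
      rw [hz, map_add, map_smul, map_smul, smul_eq_mul, smul_eq_mul]
    obtain rfl : b = 1 - a := by linarith
    simp only [phi, h3]; ring
  rw [key (T z)]
  have h4 := key z
  rw [phi_self] at h4
  linarith

end RelNonexpansive

/-! ### Real recursions. -/

section Recursion

/-- A sequence with `a (n + 1) ≤ (1 - γ n) a n` eventually tends to zero if `∑ γ = ∞`. -/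
theorem tendsto_zero_of_le_one_sub_mul {a γ : ℕ → ℝ} (ha : ∀ n, 0 ≤ a n)
    (hγ : Tendsto (fun n => ∑ i ∈ Finset.range n, γ i) atTop atTop)
    (h : ∀ᶠ n in atTop, a (n + 1) ≤ (1 - γ n) * a n) : Tendsto a atTop (𝓝 0) := by
  obtain ⟨N, hN⟩ := h.exists_forall_of_atTop
  set S : ℕ → ℝ := fun n => ∑ i ∈ Finset.range n, γ i with hS
  have hle : ∀ n ≥ N, a n ≤ a N * Real.exp (S N - S n) := by
    intro n hn
    induction n, hn using Nat.le_induction with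
    | base => simp
    | succ n hn ih =>
      have h1 : 1 - γ n ≤ Real.exp (-γ n) := by
        have := Real.add_one_le_exp (-γ n)
        linarith
      calc a (n + 1) ≤ (1 - γ n) * a n := hN n hn
        _ ≤ Real.exp (-γ n) * a n := mul_le_mul_of_nonneg_right h1 (ha n)
        _ ≤ Real.exp (-γ n) * (a N * Real.exp (S N - S n)) := by gcongr
        _ = a N * Real.exp (S N - S (n + 1)) := by
          rw [show S N - S (n + 1) = -γ n + (S N - S n) by
            simp only [hS, Finset.sum_range_succ]; ring, Real.exp_add]
          ring
  have hlim : Tendsto (fun n => a N * Real.exp (S N - S n)) atTop (𝓝 0) := by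
    have h1 : Tendsto (fun n => S N - S n) atTop atBot := by
      simp only [sub_eq_add_neg]
      exact tendsto_atBot_add_const_left _ (S N) (tendsto_neg_atTop_atBot.comp hγ)
    simpa using (Real.tendsto_exp_atBot.comp h1).const_mul (a N)
  exact tendsto_of_tendsto_of_tendsto_of_le_of_le' tendsto_const_nhds hlim
    (Eventually.of_forall ha) (eventually_atTop.2 ⟨N, hle⟩)

/-- Convergence of Halpern type recursions: the perturbation `b` has to be asymptotically
nonpositive only where the decrease `d` is small. -/
theorem tendsto_zero_of_halpern_recursion {s d b γ : ℕ → ℝ} {M : ℝ} (hs : ∀ n, 0 ≤ s n)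
    (hd : ∀ n, 0 ≤ d n) (hb : ∀ n, b n ≤ M) (hγ : ∀ n, γ n ∈ Set.Icc (0 : ℝ) 1)
    (hγ0 : Tendsto γ atTop (𝓝 0))
    (hγsum : Tendsto (fun n => ∑ i ∈ Finset.range n, γ i) atTop atTop)
    (hrec : ∀ n, s (n + 1) ≤ (1 - γ n) * (s n - d n) + γ n * b n)
    (hlim : ∀ ε > 0, ∃ τ > 0, ∀ᶠ n in atTop, d n ≤ τ → b n ≤ ε) :
    Tendsto s atTop (𝓝 0) := by
  have key : ∀ ε > 0, ∀ᶠ n in atTop, s n < ε := by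
    intro ε hε
    obtain ⟨τ, hτ, hlarge⟩ := hlim (ε / 2) (half_pos hε)
    -- Above the level ε/2 the recursion is unperturbed: either b n ≤ ε/2, or d n > τ and (1 - γ n)
    -- d n ≥ τ/2 > γ n M absorbs the perturbation.
    have ha : Tendsto (fun n => max (s n - ε / 2) 0) atTop (𝓝 0) := by
      refine tendsto_zero_of_le_one_sub_mul (fun n => le_max_right _ _) hγsum ?_
      have hγM : Tendsto (fun n => γ n * M) atTop (𝓝 0) := by simpa using hγ0.mul_const M
      filter_upwards [hlarge, hγ0.eventually_lt_const (half_pos one_pos),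
        hγM.eventually_lt_const (half_pos hτ)] with n h1 h2 h3
      have h4 : 0 ≤ γ n := (hγ n).1
      have h5 : 0 ≤ 1 - γ n := by linarith [(hγ n).2]
      have h6 := hrec n
      refine max_le ?_ (mul_nonneg h5 (le_max_right _ _))
      refine le_trans ?_ (mul_le_mul_of_nonneg_left (le_max_left _ _) h5)
      rcases le_or_gt (d n) τ with h7 | h7
      · have h8 := mul_le_mul_of_nonneg_left (h1 h7) h4
        have h9 := mul_nonneg h5 (hd n)
        linarith
      · have h8 := mul_le_mul_of_nonneg_left (hb n) h4
        have h9 : 1 / 2 * τ ≤ (1 - γ n) * d n := by gcongr; linarith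
        have h10 := mul_nonneg h4 hε.le
        linarith
    filter_upwards [ha.eventually_lt_const (half_pos hε)] with n hn
    linarith [le_max_left (s n - ε / 2) 0]
  rw [Metric.tendsto_nhds]
  intro ε hε
  filter_upwards [key ε hε] with n hn
  rwa [Real.dist_eq, sub_zero, abs_of_nonneg (hs n)]

end Recursion

/-! ### Estimates for one Halpern–Mann step. -/

section HalpernMann

variable {E : Type*} [NormedAddCommGroup E] [NormedSpace ℝ E]

theorem norm_le_of_phi_le {w x : E} {B : ℝ} (h : phi w x ≤ B) : ‖x‖ ≤ ‖w‖ + B + 1 := by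
  have h1 := sq_norm_sub_norm_le_phi w x
  nlinarith [sq_nonneg (‖x‖ - ‖w‖ - 1)]

/-- The terms linear in w cancel in aφ(w, x) + (1 - a)φ(w, y) - φ(w, z), so its value can be read
off at w = z. -/
theorem phi_add_eq_of_J_eq {x y z : E} {a : ℝ} (hz : J z = a • J x + (1 - a) • J y) (w : E) :
    phi w z + (a * phi z x + (1 - a) * phi z y) = a * phi w x + (1 - a) * phi w y := by
  have key : ∀ v, J z v = a * J x v + (1 - a) * J y v := fun v => by simp [hz]
  have h := key z
  rw [J_self] at h
  simp only [phi, key w]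
  linear_combination 2 * h

/-- The exact identity, with φ(w, u) - φ(y, u) bounded by the subgradient inequality at w. -/
theorem phi_le_of_J_eq {u y z : E} {a : ℝ} (ha : 0 ≤ a)
    (hy : J y = a • J u + (1 - a) • J z) (w : E) :
    phi w y ≤ (1 - a) * (phi w z - phi y z) + a * (2 * (J u - J w) (y - w)) := by
  have h1 := phi_add_eq_of_J_eq hy w
  have h2 := mul_le_mul_of_nonneg_left (norm_sq_sub_le w y) ha
  simp only [phi, sub_apply, map_sub] at *
  linarith

variable [UniformConvexSpace E] [CompleteSpace E] {C : Set E} {T : E → E}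

/-- If the defects of the Halpern–Mann step tend to zero along a sequence, the intermediate points
`y` asymptotically satisfy the variational inequality that characterizes the projection `w` of `u`
onto the fixed points. -/
theorem IsRelNonexpansive.exists_apply_sub_le (hE : UniformlySmooth E) (hCcl : IsClosed C)
    (hCconv : Convex ℝ C) (hT : IsRelNonexpansive C T) {u w : E}
    (hw : IsGenProj (fixedSet C T) u w) {x y z : ℕ → E} (hx : ∀ n, x n ∈ C) {R : ℝ}
    (hxR : ∀ n, ‖x n‖ ≤ R) (hyR : ∀ n, ‖y n‖ ≤ R) (hzR : ∀ n, ‖z n‖ ≤ R)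
    (hTR : ∀ n, ‖T (x n)‖ ≤ R) (hyz : Tendsto (fun n => phi (y n) (z n)) atTop (𝓝 0))
    (hzx : Tendsto (fun n => phi (z n) (x n)) atTop (𝓝 0))
    (hzT : Tendsto (fun n => phi (z n) (T (x n))) atTop (𝓝 0)) {ε : ℝ} (hε : 0 < ε) :
    ∃ n, 2 * (J u - J w) (y n - w) ≤ ε := by
  by_contra! hcon
  have h1 := tendsto_sub_of_tendsto_phi hyR hzR hyz
  have h2 := tendsto_sub_of_tendsto_phi hzR hxR hzx
  have h3 := tendsto_sub_of_tendsto_phi hzR hTR hzT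
  have hyx : Tendsto (fun n => y n - x n) atTop (𝓝 0) := by simpa using h1.add h2
  have hxT : Tendsto (fun n => x n - T (x n)) atTop (𝓝 0) := by simpa using h3.sub h2
  obtain ⟨v, k, hk, hv, hvC⟩ := hE.exists_subseq_tendsto_weak hxR
  have hvF : v ∈ fixedSet C T := hT.mem_fixedSet (hvC C hCconv hCcl hx) (fun n => hx (k n)) hv
    (hxT.comp hk.tendsto_atTop)
  have hle := hE.isGenProj_apply_sub_le (hT.1.convex_fixedSet hCconv) hw hvF
  have hlim : Tendsto (fun n => 2 * (J u - J w) (y (k n) - w)) atTop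
      (𝓝 (2 * (J u - J w) (v - w))) := by
    have h4 := ((J u - J w).continuous.tendsto 0).comp (hyx.comp hk.tendsto_atTop)
    have h5 := ((h4.add (hv (J u - J w))).sub_const ((J u - J w) w)).const_mul 2
    rw [map_zero, zero_add, ← map_sub] at h5
    refine h5.congr fun n => ?_
    simp only [Function.comp_apply, map_sub]
    ring
  have hge := ge_of_tendsto' hlim fun n => (hcon (k n)).le
  rw [sub_apply] at hge
  linarith

end HalpernMann

end BanachGeom

/-! ### The convergence theorem. -/

open BanachGeom

theorem theorem5p4 {E : Type*} [NormedAddCommGroup E] [NormedSpace ℝ E] [CompleteSpace E]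
    [UniformConvexSpace E] (hE : BanachGeom.UniformlySmooth E)
    (C : Set E) (hCne : C.Nonempty) (hCcl : IsClosed C) (hCconv : Convex ℝ C)
    (T : E → E) (hT : BanachGeom.IsRelNonexpansive C T)
    (α β : ℕ → ℝ)
    (hα : ∀ n, α n ∈ Set.Ioc (0 : ℝ) 1) (hβ : ∀ n, β n ∈ Set.Icc (0 : ℝ) 1)
    (hα0 : Tendsto α atTop (𝓝 0))
    (hαsum : Tendsto (fun n => ∑ i ∈ Finset.range n, α i) atTop atTop)
    (hβinf : 0 < liminf β atTop) (hβsup : limsup β atTop < 1)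
    (u : E) (x : ℕ → E) (hx0 : x 0 ∈ C)
    (hx : ∀ n, x (n + 1) = BanachGeom.genProj C (BanachGeom.Jinv
      (α n • BanachGeom.J u +
        (1 - α n) • (β n • BanachGeom.J (x n) + (1 - β n) • BanachGeom.J (T (x n)))))) :
    (∃! w, BanachGeom.IsGenProj (BanachGeom.fixedSet C T) u w) ∧
      Tendsto x atTop (𝓝 (BanachGeom.genProj (BanachGeom.fixedSet C T) u)) := by
  have hFcl := hT.isClosed_fixedSet hCcl
  have hFconv := hT.1.convex_fixedSet hCconv
  refine ⟨hE.existsUnique_isGenProj hT.1.1 hFcl hFconv u, ?_⟩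
  have hw := hE.isGenProj_genProj hT.1.1 hFcl hFconv u
  set w := genProj (fixedSet C T) u
  let z : ℕ → E := fun n => Jinv (β n • J (x n) + (1 - β n) • J (T (x n)))
  let y : ℕ → E := fun n => Jinv (α n • J u + (1 - α n) • J (z n))
  have hJz : ∀ n, J (z n) = β n • J (x n) + (1 - β n) • J (T (x n)) := fun n => hE.J_Jinv _
  have hJy : ∀ n, J (y n) = α n • J u + (1 - α n) • J (z n) := fun n => hE.J_Jinv _
  have hproj : ∀ n, IsGenProj C (y n) (x (n + 1)) := fun n => by
    rw [hx n, ← hJz]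
    exact hE.isGenProj_genProj hCne hCcl hCconv _
  have hxC : ∀ n, x n ∈ C := fun n => by
    cases n with
    | zero => exact hx0
    | succ n => exact (hproj n).1
  have hα' : ∀ n, 0 ≤ α n ∧ 0 ≤ 1 - α n := fun n => ⟨(hα n).1.le, sub_nonneg.2 (hα n).2⟩
  have hβ' : ∀ n, 0 ≤ β n ∧ 0 ≤ 1 - β n := fun n => ⟨(hβ n).1, sub_nonneg.2 (hβ n).2⟩
  have hwT : ∀ n, phi w (T (x n)) ≤ phi w (x n) := fun n => hT.1.2 _ (hxC n) w hw.1
  have hwy : ∀ n, phi w (x (n + 1)) ≤ phi w (y n) := fun n => by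
    linarith [hE.phi_add_phi_le hCconv (hproj n) hw.1.1, phi_nonneg (x (n + 1)) (y n)]
  have hwz : ∀ n, phi w (z n) + (β n * phi (z n) (x n) + (1 - β n) * phi (z n) (T (x n))) ≤
      phi w (x n) := fun n => by
    have h1 := phi_add_eq_of_J_eq (hJz n) w
    have h2 := mul_le_mul_of_nonneg_left (hwT n) (hβ' n).2
    linarith
  have hmann : ∀ n, 0 ≤ β n * phi (z n) (x n) ∧ 0 ≤ (1 - β n) * phi (z n) (T (x n)) := fun n =>
    ⟨mul_nonneg (hβ' n).1 (phi_nonneg _ _), mul_nonneg (hβ' n).2 (phi_nonneg _ _)⟩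
  have hwz' : ∀ n, phi w (z n) ≤ phi w (x n) := fun n => by linarith [hwz n, hmann n]
  set B := max (phi w (x 0)) (phi w u)
  have hyB : ∀ n, phi w (x n) ≤ B → phi w (y n) ≤ B := fun n hn => by
    have h1 := phi_add_eq_of_J_eq (hJy n) w
    have h2 := mul_nonneg (hα' n).1 (phi_nonneg (y n) u)
    have h3 := mul_nonneg (hα' n).2 (phi_nonneg (y n) (z n))
    have h4 := mul_le_mul_of_nonneg_left (le_max_right (phi w (x 0)) (phi w u)) (hα' n).1
    have h5 := mul_le_mul_of_nonneg_left ((hwz' n).trans hn) (hα' n).2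
    linarith
  have hxB : ∀ n, phi w (x n) ≤ B := fun n => by
    induction n with
    | zero => exact le_max_left _ _
    | succ n ih => exact (hwy n).trans (hyB n ih)
  set R := ‖w‖ + B + 1
  have hxR : ∀ n, ‖x n‖ ≤ R := fun n => norm_le_of_phi_le (hxB n)
  have hyR : ∀ n, ‖y n‖ ≤ R := fun n => norm_le_of_phi_le (hyB n (hxB n))
  have hzR : ∀ n, ‖z n‖ ≤ R := fun n => norm_le_of_phi_le ((hwz' n).trans (hxB n))
  have hTR : ∀ n, ‖T (x n)‖ ≤ R := fun n => norm_le_of_phi_le ((hwT n).trans (hxB n))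
  let d : ℕ → ℝ := fun n =>
    phi (y n) (z n) + (β n * phi (z n) (x n) + (1 - β n) * phi (z n) (T (x n)))
  have hd : ∀ n, d n = phi (y n) (z n) +
    (β n * phi (z n) (x n) + (1 - β n) * phi (z n) (T (x n))) := fun n => rfl
  have hs : Tendsto (fun n => phi w (x n)) atTop (𝓝 0) := by
    refine tendsto_zero_of_halpern_recursion (d := d)
      (b := fun n => 2 * (J u - J w) (y n - w)) (M := 2 * (‖J u - J w‖ * (R + ‖w‖)))
      (fun n => phi_nonneg _ _) (fun n => ?_) (fun n => ?_) (fun n => ⟨(hα' n).1, (hα n).2⟩)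
      hα0 hαsum (fun n => ?_) fun ε hε => ?_
    · linarith [hd n, hmann n, phi_nonneg (y n) (z n)]
    · gcongr
      refine (Real.le_norm_self _).trans (((J u - J w).le_opNorm _).trans ?_)
      gcongr
      exact (norm_sub_le _ _).trans (by gcongr; exact hyR n)
    · have h1 := phi_le_of_J_eq (hα' n).1 (hJy n) w
      have h2 : phi w (z n) - phi (y n) (z n) ≤ phi w (x n) - d n := by linarith [hwz n, hd n]
      linarith [hwy n, mul_le_mul_of_nonneg_left h2 (hα' n).2]
    -- Failure for every τ = 1/(j + 1) yields a subsequence with d → 0 and b > ε throughout.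
    · by_contra! hcon
      obtain ⟨k, hk, hkd⟩ := extraction_forall_of_frequently
        (P := fun j n => d n ≤ 1 / ((j : ℝ) + 1) ∧ ε < 2 * (J u - J w) (y n - w)) fun j => by
          simpa only [not_eventually, Classical.not_imp, not_le] using
            hcon (1 / ((j : ℝ) + 1)) (by positivity)
      have hdk : Tendsto (fun j => d (k j)) atTop (𝓝 0) :=
        squeeze_zero (fun j => by linarith [hd (k j), hmann (k j), phi_nonneg (y (k j)) (z (k j))])
          (fun j => (hkd j).1) tendsto_one_div_add_atTop_nhds_zero_nat
      have hsmall : ∀ (c : ℝ) (p : ℕ → ℝ), 0 < c → (∀ n, 0 ≤ p n) →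
          (∀ᶠ n in atTop, c * p n ≤ d n) → Tendsto (fun j => p (k j)) atTop (𝓝 0) := by
        intro c p hc hp hcp
        refine squeeze_zero' (Eventually.of_forall fun j => hp _) (g := fun j => d (k j) / c) ?_
          (by simpa using hdk.div_const c)
        filter_upwards [hk.tendsto_atTop.eventually hcp] with j hj
        rwa [le_div_iff₀ hc, mul_comm]
      have hβbdd : IsBoundedUnder (· ≥ ·) atTop β := isBoundedUnder_of ⟨0, fun n => (hβ n).1⟩
      have hβbdd' : IsBoundedUnder (· ≤ ·) atTop β := isBoundedUnder_of ⟨1, fun n => (hβ n).2⟩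
      -- The weights β n and 1 - β n are eventually bounded below, so d → 0 forces each φ term in d
      -- to 0.
      have hlow := eventually_lt_of_lt_liminf (half_lt_self hβinf) hβbdd
      obtain ⟨c, hc, hc1⟩ := exists_between hβsup
      have hupp := eventually_lt_of_limsup_lt hc hβbdd'
      obtain ⟨j, hj⟩ := hT.exists_apply_sub_le hE hCcl hCconv hw (fun j => hxC (k j))
        (fun j => hxR (k j)) (fun j => hyR (k j)) (fun j => hzR (k j)) (fun j => hTR (k j))
        (hsmall 1 (fun n => phi (y n) (z n)) one_pos (fun n => phi_nonneg _ _)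
          (Eventually.of_forall fun n => by linarith [hd n, hmann n]))
        (hsmall _ (fun n => phi (z n) (x n)) (half_pos hβinf) (fun n => phi_nonneg _ _) (by
          filter_upwards [hlow] with n hn
          have := mul_le_mul_of_nonneg_right hn.le (phi_nonneg (z n) (x n))
          linarith [hd n, hmann n, phi_nonneg (y n) (z n)]))
        (hsmall (1 - c) (fun n => phi (z n) (T (x n))) (sub_pos.2 hc1) (fun n => phi_nonneg _ _) (by
          filter_upwards [hupp] with n hn
          have := mul_le_mul_of_nonneg_right (sub_le_sub_left hn.le 1)
            (phi_nonneg (z n) (T (x n)))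
          linarith [hd n, hmann n, phi_nonneg (y n) (z n)])) hε
      exact absurd (hkd j).2 hj.not_gt
  have hwR : ‖w‖ ≤ R := norm_le_of_phi_le ((phi_self w).trans_le ((phi_nonneg _ _).trans (hxB 0)))
  simpa using (tendsto_sub_of_tendsto_phi (fun _ => hwR) hxR hs).const_sub w
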